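/- Let $H\neq 0$ be a separable complex Hilbert space. A finite or infinite (countable) real sequence $\xi=\langle \xi_j\rangle$ is said to satisfy the Kadison condition if $0\le \xi_j\le 1$ for every $j$ and, with $$a=\sum\{\xi_j \mid \xi_j\le \tfrac12\},\qquad b=\sum\{1-\xi_j\mid \xi_j>\tfrac12\},$$ either $a+b=\infty$, or $a$ and $b$ are finite and $a-b\in\mathbb Z$. Theorem. Let $\xi=\langle\xi_j\rangle$ be a sequence satisfying the Kadison condition. Let $A\in B(H)$ be a sum of (finitely or infinitely many) orthogonal projections, where the series converges in the strong operator topology if there are infinitely many, and suppose that $\operatorname{tr}(A)=\sum_j\xi_j$ (as elements of $[0,\infty]$). Then $\xi$ is admissible for $A$, that is, there are rank-one orthogonal projections $P_j$ such that $$A=\sum_j \xi_jP_j,$$ where the series converges in the strong operator topology if the sequence is infinite. -/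

import Mathlib

open scoped ENNReal

/-- The Kadison condition for a finite or infinite sequence `ξ`, indexed by a set `ι`:
all terms lie in `[0, 1]` and, with
`a = ∑ {ξ i | ξ i ≤ 1/2}` and `b = ∑ {1 - ξ i | ξ i > 1/2}` in `[0, ∞]`,
either `a + b = ∞`, or `a` and `b` are finite and `a - b` is an integer. -/
def KadisonCondition {ι : Type*} (ξ : ι → ℝ) : Prop :=
  (∀ i, 0 ≤ ξ i ∧ ξ i ≤ 1) ∧
    ((∑' i : {i // ξ i ≤ 1 / 2}, ENNReal.ofReal (ξ i)) +
        (∑' i : {i // 1 / 2 < ξ i}, ENNReal.ofReal (1 - ξ i)) = ∞ ∨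
      (∑' i : {i // ξ i ≤ 1 / 2}, ENNReal.ofReal (ξ i)) ≠ ∞ ∧
        (∑' i : {i // 1 / 2 < ξ i}, ENNReal.ofReal (1 - ξ i)) ≠ ∞ ∧
        ∃ k : ℤ,
          (∑' i : {i // ξ i ≤ 1 / 2}, ENNReal.ofReal (ξ i)).toReal -
            (∑' i : {i // 1 / 2 < ξ i}, ENNReal.ofReal (1 - ξ i)).toReal = k)

/-- The trace `∑ ⟨A e_k, e_k⟩ ∈ [0, ∞]` of a positive operator `A`, computed in the
orthonormal basis `e`. -/
noncomputable def positiveTrace {H : Type*} [NormedAddCommGroup H] [InnerProductSpace ℂ H]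
    {κ : Type*} (e : HilbertBasis κ ℂ H) (A : H →L[ℂ] H) : ℝ≥0∞ :=
  ∑' k, ENNReal.ofReal (inner ℂ (e k) (A (e k))).re

/-- `A` is a sum of (orthogonal) projections: the partial sums of a sequence of projections
converge to `A` in the strong operator topology. Since the zero operator is a projection,
finite sums of projections are included. -/
def IsSumOfProjections {H : Type*} [NormedAddCommGroup H] [InnerProductSpace ℂ H]
    [CompleteSpace H] (A : H →L[ℂ] H) : Prop :=
  ∃ E : ℕ → H →L[ℂ] H, (∀ j, IsStarProjection (E j)) ∧
    ∀ x : H, Filter.Tendsto (fun n => ∑ j ∈ Finset.range n, E j x) Filter.atTop (nhds (A x))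

/-- `P` is an (orthogonal) projection of rank one. -/
def IsRankOneProjection {H : Type*} [NormedAddCommGroup H] [InnerProductSpace ℂ H]
    [CompleteSpace H] (P : H →L[ℂ] H) : Prop :=
  IsStarProjection P ∧ Module.finrank ℂ (P : H →ₗ[ℂ] H).range = 1

/-- `ξ` is admissible for `A`: `A = ∑ ξ j • P j` for some rank-one projections `P j`. For a
finite index set this is a finite sum; for an infinite one the series converges (in any order)
in the strong operator topology. -/
def IsAdmissible {H : Type*} [NormedAddCommGroup H] [InnerProductSpace ℂ H]
    [CompleteSpace H] {ι : Type*} (ξ : ι → ℝ) (A : H →L[ℂ] H) : Prop :=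
  ∃ P : ι → H →L[ℂ] H, (∀ j, IsRankOneProjection (P j)) ∧
    ∀ x : H, HasSum (fun j => (ξ j : ℂ) • P j x) (A x)

/-!
A positive operator `A` is a strongly convergent sum `∑ ξ i • P i` of rank-one projections as soon
as there are vectors `x i` with `‖x i‖ ^ 2 = ξ i` and `⟪A v, v⟫ = ∑ ‖⟪x i, v⟫‖ ^ 2` for all `v`
(`isAdmissible_of_hasSum`). A sum of projections has such a family consisting of unit vectors, and
the trace of `A` is their number, so the task is to trade unit vectors for vectors with the
prescribed norms without changing the quadratic form.

This is done greedily (`IsGreedyRun`). A residual vector `r` with `‖r‖ ≤ 1` is kept. To produce a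
vector of squared norm `t`, split `r` into two multiples of itself if `t ≤ ‖r‖ ^ 2`; otherwise
take a fresh unit vector `u` and rotate the pair `r, u` into a vector of squared norm `t` and a new
residual `r' = c • u + s • r`. In both cases the old residual enters the new one with a coefficient
`s` such that `s ^ 2 ≤ max t (1 - t)`. The quadratic form is preserved up to `‖⟪r, v⟫‖ ^ 2`, so
everything depends on what happens to the residual.

* If `∑ min (ξ i) (1 - ξ i) = ∞`, the product of the coefficients `s` is `0`, and since the fresh
  vectors are square summable against every `v`, the residual tends weakly to `0`.
* If the supply is `M` unit vectors and an initial residual `r₀`, and the targets have the total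
  `M + ‖r₀‖ ^ 2`, the residual tends to `0` in norm.
* If the targets are `1 - δ n` with `∑ δ n = β < 1`, every step uses a fresh vector, and the
  residual converges in norm to a vector of squared norm `β`.

The divergent Kadison condition is the first case, and an operator of finite trace the second. In
the remaining case the third construction, applied to all but finitely many of the terms above
`1 / 2`, leaves a residual that feeds the second one for the other terms; integrality of `a - b` is
what makes the totals match (`exists_hasSum_of_tsum_ne_top`).
-/

/-! ### Splitting and rotating pairs of vectors -/

section Greedy

variable {H : Type*} [NormedAddCommGroup H] [InnerProductSpace ℂ H]

/-- One step of the greedy construction. From a residual vector `r` and a fresh vector `f`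
(which is `0` if none is used), the step produces a vector `x` with `‖x‖ ^ 2 = t` and a new
residual `r' = c • f + s • r`, such that `x, r'` and `r, f` have the same frame operator. The
coefficient bounds measure how much of the old residual survives. -/
structure IsGreedyStep (t : ℝ) (f r x r' : H) (c : ℂ) (s : ℝ) : Prop where
  norm_sq_left : ‖x‖ ^ 2 = t
  norm_sq_right : ‖r'‖ ^ 2 = ‖r‖ ^ 2 + ‖f‖ ^ 2 - t
  parseval : ∀ v, ‖inner ℂ x v‖ ^ 2 + ‖inner ℂ r' v‖ ^ 2
    = ‖inner ℂ r v‖ ^ 2 + ‖inner ℂ f v‖ ^ 2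
  right_eq : r' = c • f + (s : ℂ) • r
  coeff_nonneg : 0 ≤ s
  coeff_sq_add_sq_le : ‖c‖ ^ 2 + s ^ 2 ≤ 1
  coeff_sq_le : s ^ 2 ≤ max t (1 - t)

theorem exists_unit_smul_inner_re_eq_zero (u r : H) :
    ∃ ω : ℂ, ‖ω‖ = 1 ∧ (inner ℂ (ω • u) r).re = 0 := by
  by_cases hz : inner ℂ u r = 0
  · exact ⟨1, by simp, by simp [hz]⟩
  · have hn : (‖inner ℂ u r‖ : ℂ) ≠ 0 := by exact_mod_cast norm_ne_zero_iff.2 hz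
    refine ⟨Complex.I * inner ℂ u r / ‖inner ℂ u r‖, ?_, ?_⟩
    · simp only [norm_div, norm_mul, Complex.norm_I, one_mul, Complex.norm_real, norm_norm]
      exact div_self (norm_ne_zero_iff.2 hz)
    · rw [inner_smul_left]
      have : (starRingEnd ℂ) (Complex.I * inner ℂ u r / ‖inner ℂ u r‖) * inner ℂ u r
          = -Complex.I * (‖inner ℂ u r‖ : ℂ) := by
        rw [map_div₀, map_mul, Complex.conj_I, Complex.conj_ofReal, div_mul_eq_mul_div,
          mul_assoc, Complex.conj_mul']
        field_simp
      rw [this]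
      simp

theorem norm_sq_real_smul_add (u r : H) (h : (inner ℂ u r).re = 0) (c s : ℝ) :
    ‖(c : ℂ) • u + (s : ℂ) • r‖ ^ 2 = c ^ 2 * ‖u‖ ^ 2 + s ^ 2 * ‖r‖ ^ 2 := by
  rw [@norm_add_sq ℂ, inner_smul_left, inner_smul_right, norm_smul, norm_smul]
  simp [mul_pow, h]

theorem norm_sq_rotation (z w : ℂ) (c s : ℝ) (h : c ^ 2 + s ^ 2 = 1) :
    ‖(s : ℂ) * z - c * w‖ ^ 2 + ‖(c : ℂ) * z + s * w‖ ^ 2 = ‖w‖ ^ 2 + ‖z‖ ^ 2 := by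
  simp only [Complex.sq_norm, Complex.normSq_apply, Complex.sub_re, Complex.sub_im,
    Complex.add_re, Complex.add_im, Complex.re_ofReal_mul, Complex.im_ofReal_mul]
  linear_combination (z.re ^ 2 + z.im ^ 2 + w.re ^ 2 + w.im ^ 2) * h

/-- If `t ≤ ‖r‖ ^ 2`, the residual is split into two multiples of itself. -/
theorem exists_isGreedyStep_of_le {t : ℝ} (ht : 0 ≤ t) {r : H} (hr : ‖r‖ ^ 2 ≤ 1)
    (h : t ≤ ‖r‖ ^ 2) : ∃ x r' s, IsGreedyStep t 0 r x r' 0 s := by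
  have hd : t / ‖r‖ ^ 2 ≤ 1 := div_le_one_of_le₀ h (by positivity)
  have hm : t / ‖r‖ ^ 2 * ‖r‖ ^ 2 = t := by
    rcases eq_or_ne (‖r‖ ^ 2) 0 with h0 | h0
    · have : t = 0 := le_antisymm (h0 ▸ h) ht
      simp [this]
    · exact div_mul_cancel₀ _ h0
  have h1 : √(t / ‖r‖ ^ 2) ^ 2 = t / ‖r‖ ^ 2 := Real.sq_sqrt (by positivity)
  have h2 : √(1 - t / ‖r‖ ^ 2) ^ 2 = 1 - t / ‖r‖ ^ 2 := Real.sq_sqrt (by linarith)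
  have hle : t ≤ t / ‖r‖ ^ 2 := by
    have : 0 ≤ t / ‖r‖ ^ 2 := by positivity
    nlinarith
  refine ⟨((√(t / ‖r‖ ^ 2) : ℝ) : ℂ) • r, ((√(1 - t / ‖r‖ ^ 2) : ℝ) : ℂ) • r,
    √(1 - t / ‖r‖ ^ 2), ?_, ?_, fun v => ?_, ?_, ?_, ?_, ?_⟩
  · rw [norm_smul, mul_pow, Complex.norm_real, Real.norm_eq_abs, sq_abs, h1, hm]
  · rw [norm_smul, mul_pow, Complex.norm_real, Real.norm_eq_abs, sq_abs, h2, sub_mul, hm]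
    simp
  · simp only [inner_smul_left, norm_mul, mul_pow, Complex.conj_ofReal, Complex.norm_real,
      Real.norm_eq_abs, sq_abs, h1, h2, inner_zero_left, norm_zero]
    ring
  · simp
  · positivity
  · rw [h2]
    have : 0 ≤ t / ‖r‖ ^ 2 := by positivity
    simp; linarith
  · rw [h2]; exact le_max_of_le_right (by linarith)

/-- If `‖r‖ ^ 2 < t ≤ 1`, the residual is rotated against a fresh unit vector. After a change
of phase of `u` the two vectors are orthogonal in the real sense, which makes the angle
explicit: `‖c‖ ^ 2 = (1 - t) / (1 - ‖r‖ ^ 2)`. -/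
theorem exists_isGreedyStep_of_lt {t : ℝ} (ht : t ≤ 1) {r u : H} (hu : ‖u‖ = 1)
    (h : ‖r‖ ^ 2 < t) : ∃ x r' c s, IsGreedyStep t u r x r' c s ∧ ‖c‖ ^ 2 + s ^ 2 = 1 ∧
      ‖c‖ ^ 2 * (1 - ‖r‖ ^ 2) = 1 - t := by
  obtain ⟨ω, hω, hre⟩ := exists_unit_smul_inner_re_eq_zero u r
  have hu' : ‖ω • u‖ = 1 := by rw [norm_smul, hω, hu, one_mul]
  have hpos : 0 < 1 - ‖r‖ ^ 2 := by linarith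
  have hr0 : 0 ≤ ‖r‖ ^ 2 := by positivity
  set ρ := ‖r‖ ^ 2 with hρ
  have h1 : √((1 - t) / (1 - ρ)) ^ 2 = (1 - t) / (1 - ρ) :=
    Real.sq_sqrt (div_nonneg (by linarith) hpos.le)
  have h2 : √((t - ρ) / (1 - ρ)) ^ 2 = (t - ρ) / (1 - ρ) :=
    Real.sq_sqrt (div_nonneg (by linarith) hpos.le)
  set c := √((1 - t) / (1 - ρ)) with hc
  set s := √((t - ρ) / (1 - ρ)) with hs
  have hcs : c ^ 2 + s ^ 2 = 1 := by
    rw [h1, h2]; field_simp; ring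
  have hcm : c ^ 2 * (1 - ρ) = 1 - t := by rw [h1]; field_simp
  have hsm : s ^ 2 * (1 - ρ) = t - ρ := by rw [h2]; field_simp
  have hc' : ‖(c : ℂ) * ω‖ ^ 2 = c ^ 2 := by
    rw [norm_mul, hω, mul_one, Complex.norm_real, Real.norm_eq_abs, sq_abs]
  refine ⟨(s : ℂ) • (ω • u) + ((-c : ℝ) : ℂ) • r, (c : ℂ) • (ω • u) + (s : ℂ) • r,
    (c : ℂ) * ω, s, ⟨?_, ?_, fun v => ?_, ?_, Real.sqrt_nonneg _, ?_, ?_⟩, ?_, ?_⟩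
  · rw [norm_sq_real_smul_add _ _ hre, hu', ← hρ]; linarith
  · rw [norm_sq_real_smul_add _ _ hre, hu', hu, ← hρ]; linarith
  · have h3 : ‖inner ℂ u v‖ ^ 2 = ‖inner ℂ (ω • u) v‖ ^ 2 := by
      rw [inner_smul_left, norm_mul, RCLike.norm_conj, hω, one_mul]
    have e1 : inner ℂ ((s : ℂ) • (ω • u) + ((-c : ℝ) : ℂ) • r) v
        = s * inner ℂ (ω • u) v - c * inner ℂ r v := by
      rw [inner_add_left, inner_smul_left _ _ (s : ℂ), inner_smul_left r, Complex.conj_ofReal,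
        Complex.conj_ofReal, Complex.ofReal_neg]
      ring
    have e2 : inner ℂ ((c : ℂ) • (ω • u) + (s : ℂ) • r) v
        = c * inner ℂ (ω • u) v + s * inner ℂ r v := by
      rw [inner_add_left, inner_smul_left _ _ (c : ℂ), inner_smul_left r, Complex.conj_ofReal,
        Complex.conj_ofReal]
    rw [h3, e1, e2, norm_sq_rotation _ _ c s hcs]
  · rw [mul_smul]
  · rw [hc']; exact hcs.le
  · refine le_max_of_le_left ?_
    rw [h2, div_le_iff₀ hpos]; nlinarith
  · rw [hc']; exact hcs
  · rw [hc']; exact hcm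

/-! ### The greedy construction -/

/-- The greedy run on targets `t` with supply `u` of unit vectors: `k n` vectors of the supply
have been used before step `n`, and step `n` uses `f n`, which is `u (k n)` if the residual
`r n` is too short for the target `t n`, and `0` otherwise. -/
structure IsGreedyRun (t : ℕ → ℝ) (u : ℕ → H) (k : ℕ → ℕ) (f x r : ℕ → H) (c : ℕ → ℂ)
    (s : ℕ → ℝ) : Prop where
  step : ∀ n, IsGreedyStep (t n) (f n) (r n) (x n) (r (n + 1)) (c n) (s n)
  count_zero : k 0 = 0
  of_le : ∀ n, t n ≤ ‖r n‖ ^ 2 → k (n + 1) = k n ∧ f n = 0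
  of_lt : ∀ n, ‖r n‖ ^ 2 < t n → k (n + 1) = k n + 1 ∧ f n = u (k n) ∧
    ‖c n‖ ^ 2 + s n ^ 2 = 1 ∧ ‖c n‖ ^ 2 * (1 - ‖r n‖ ^ 2) = 1 - t n
  norm_sq_le_one : ∀ n, ‖r n‖ ^ 2 ≤ 1

theorem exists_isGreedyRun {t : ℕ → ℝ} (ht : ∀ n, 0 ≤ t n ∧ t n ≤ 1) {u : ℕ → H}
    (hu : ∀ n, ‖u n‖ = 1) {r₀ : H} (hr₀ : ‖r₀‖ ^ 2 ≤ 1) :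
    ∃ k f x r c s, IsGreedyRun t u k f x r c s ∧ r 0 = r₀ := by
  have key : ∀ (n : ℕ) (p : ℕ × {r : H // ‖r‖ ^ 2 ≤ 1}),
      ∃ (p' : ℕ × {r : H // ‖r‖ ^ 2 ≤ 1}) (f x : H) (c : ℂ) (s : ℝ),
        IsGreedyStep (t n) f p.2 x p'.2 c s ∧
        (t n ≤ ‖(p.2 : H)‖ ^ 2 → p'.1 = p.1 ∧ f = 0) ∧
        (‖(p.2 : H)‖ ^ 2 < t n → p'.1 = p.1 + 1 ∧ f = u p.1 ∧ ‖c‖ ^ 2 + s ^ 2 = 1 ∧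
          ‖c‖ ^ 2 * (1 - ‖(p.2 : H)‖ ^ 2) = 1 - t n) := by
    rintro n ⟨m, r, hr⟩
    rcases le_or_gt (t n) (‖r‖ ^ 2) with h | h
    · obtain ⟨x, r', s, hs⟩ := exists_isGreedyStep_of_le (ht n).1 hr h
      have hr' : ‖r'‖ ^ 2 ≤ 1 := by
        have := hs.norm_sq_right
        have := (ht n).1
        simp only [norm_zero] at *
        linarith
      exact ⟨(m, ⟨r', hr'⟩), 0, x, 0, s, hs, fun _ => ⟨rfl, rfl⟩,
        fun h' => absurd h (not_le.2 h')⟩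
    · obtain ⟨x, r', c, s, hs, h1, h2⟩ := exists_isGreedyStep_of_lt (ht n).2 (hu m) h
      have hr' : ‖r'‖ ^ 2 ≤ 1 := by
        have := hs.norm_sq_right
        rw [hu m] at this
        linarith
      exact ⟨(m + 1, ⟨r', hr'⟩), u m, x, c, s, hs, fun h' => absurd h (not_lt.2 h'),
        fun _ => ⟨rfl, rfl, h1, h2⟩⟩
  choose next f x c s hstep hle hlt using key
  let p : ℕ → ℕ × {r : H // ‖r‖ ^ 2 ≤ 1} := fun n =>
    Nat.rec (0, ⟨r₀, hr₀⟩) (fun n q => next n q) n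
  exact ⟨fun n => (p n).1, fun n => f n (p n), fun n => x n (p n), fun n => (p n).2,
    fun n => c n (p n), fun n => s n (p n),
    ⟨fun n => hstep n (p n), rfl, fun n => hle n (p n), fun n => hlt n (p n),
      fun n => (p n).2.2⟩, rfl⟩

namespace IsGreedyRun

variable {t : ℕ → ℝ} {u : ℕ → H} {k : ℕ → ℕ} {f x r : ℕ → H} {c : ℕ → ℂ} {s : ℕ → ℝ}

theorem sum_fresh (h : IsGreedyRun t u k f x r c s) (g : H → ℝ) (hg : g 0 = 0) (n : ℕ) :
    ∑ i ∈ Finset.range n, g (f i) = ∑ i ∈ Finset.range (k n), g (u i) := by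
  induction n with
  | zero => simp [h.count_zero]
  | succ n ih =>
    rw [Finset.sum_range_succ, ih]
    rcases le_or_gt (t n) (‖r n‖ ^ 2) with h' | h'
    · obtain ⟨h1, h2⟩ := h.of_le n h'
      rw [h1, h2, hg, add_zero]
    · obtain ⟨h1, h2, -⟩ := h.of_lt n h'
      rw [h1, h2, Finset.sum_range_succ]

theorem sum_norm_sq_inner (h : IsGreedyRun t u k f x r c s) (v : H) (n : ℕ) :
    ∑ i ∈ Finset.range n, ‖inner ℂ (x i) v‖ ^ 2 + ‖inner ℂ (r n) v‖ ^ 2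
      = ‖inner ℂ (r 0) v‖ ^ 2 + ∑ i ∈ Finset.range (k n), ‖inner ℂ (u i) v‖ ^ 2 := by
  rw [← h.sum_fresh (fun w => ‖inner ℂ w v‖ ^ 2) (by simp)]
  induction n with
  | zero => simp
  | succ n ih =>
    rw [Finset.sum_range_succ, Finset.sum_range_succ]
    have := (h.step n).parseval v
    linarith

theorem norm_sq_residual (h : IsGreedyRun t u k f x r c s) (hu : ∀ n, ‖u n‖ = 1) (n : ℕ) :
    ‖r n‖ ^ 2 = ‖r 0‖ ^ 2 + k n - ∑ i ∈ Finset.range n, t i := by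
  have h1 : (k n : ℝ) = ∑ i ∈ Finset.range n, ‖f i‖ ^ 2 := by
    rw [h.sum_fresh (fun w => ‖w‖ ^ 2) (by simp)]
    simp [hu]
  rw [h1]
  induction n with
  | zero => simp
  | succ n ih =>
    rw [Finset.sum_range_succ, Finset.sum_range_succ, (h.step n).norm_sq_right, ih ?_]
    · ring
    · rw [h.sum_fresh (fun w => ‖w‖ ^ 2) (by simp)]
      simp [hu]

/-- After `j` further steps, the residual is what survives of the earlier one plus a
combination of fresh vectors, controlled by Cauchy-Schwarz. -/
theorem exists_residual_eq (h : IsGreedyRun t u k f x r c s) (m j : ℕ) :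
    ∃ w : H, r (m + j) = ((∏ i ∈ Finset.range j, s (m + i) : ℝ) : ℂ) • r m + w ∧
      ∀ v, ‖inner ℂ w v‖ ^ 2 ≤ (1 - (∏ i ∈ Finset.range j, s (m + i)) ^ 2) *
        ∑ i ∈ Finset.range j, ‖inner ℂ (f (m + i)) v‖ ^ 2 := by
  induction j with
  | zero => exact ⟨0, by simp, by simp⟩
  | succ j ih =>
    obtain ⟨w, hw, hb⟩ := ih
    have hs := h.step (m + j)
    refine ⟨c (m + j) • f (m + j) + (s (m + j) : ℂ) • w, ?_, fun v => ?_⟩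
    · rw [← add_assoc, hs.right_eq, hw, Finset.prod_range_succ, smul_add, smul_smul]
      push_cast
      rw [mul_comm]
      abel
    · rw [Finset.prod_range_succ, Finset.sum_range_succ]
      have hP : 0 ≤ 1 - (∏ i ∈ Finset.range j, s (m + i)) ^ 2 := by
        have : ∏ i ∈ Finset.range j, s (m + i) ≤ 1 := by
          refine Finset.prod_le_one (fun i _ => (h.step _).coeff_nonneg) fun i _ => ?_
          have := (h.step (m + i)).coeff_sq_add_sq_le
          have h0 := sq_nonneg ‖c (m + i)‖
          exact (sq_le_one_iff₀ (h.step _).coeff_nonneg).1 (by linarith)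
        have h0 : 0 ≤ ∏ i ∈ Finset.range j, s (m + i) :=
          Finset.prod_nonneg fun i _ => (h.step _).coeff_nonneg
        nlinarith
      have hQ : 0 ≤ ∑ i ∈ Finset.range j, ‖inner ℂ (f (m + i)) v‖ ^ 2 :=
        Finset.sum_nonneg fun _ _ => by positivity
      have hbv := hb v
      generalize hPe : ∏ i ∈ Finset.range j, s (m + i) = P at *
      generalize ∑ i ∈ Finset.range j, ‖inner ℂ (f (m + i)) v‖ ^ 2 = Q at *
      have hn : ‖inner ℂ (c (m + j) • f (m + j) + (s (m + j) : ℂ) • w) v‖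
          ≤ ‖c (m + j)‖ * ‖inner ℂ (f (m + j)) v‖ + s (m + j) * ‖inner ℂ w v‖ := by
        rw [inner_add_left, inner_smul_left, inner_smul_left]
        refine (norm_add_le _ _).trans_eq ?_
        rw [norm_mul, norm_mul, RCLike.norm_conj, RCLike.norm_conj, Complex.norm_real,
          Real.norm_of_nonneg hs.coeff_nonneg]
      have h2 := hs.coeff_sq_add_sq_le
      have hs0 := hs.coeff_nonneg
      generalize s (m + j) = σ at *
      generalize ‖c (m + j)‖ = γ at *
      have ha0 := norm_nonneg (inner ℂ (f (m + j)) v)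
      have hb0 := norm_nonneg (inner ℂ w v)
      generalize ‖inner ℂ (f (m + j)) v‖ = a at *
      generalize ‖inner ℂ w v‖ = b at *
      have hb' : b ≤ √(1 - P ^ 2) * √Q := by
        rw [← Real.sqrt_mul hP]; exact Real.le_sqrt_of_sq_le hbv
      have e1 := Real.sq_sqrt hP
      have e2 := Real.sq_sqrt hQ
      generalize √(1 - P ^ 2) = p at *
      generalize √Q = q at *
      calc _ ≤ (γ * a + σ * b) ^ 2 := by gcongr
        _ ≤ (γ * a + σ * (p * q)) ^ 2 := by
            have : 0 ≤ γ * a + σ * b := (norm_nonneg _).trans hn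
            gcongr
        _ ≤ (γ ^ 2 + (σ * p) ^ 2) * (a ^ 2 + q ^ 2) := by
            nlinarith [sq_nonneg (γ * q - σ * p * a)]
        _ ≤ (1 - (P * σ) ^ 2) * (Q + a ^ 2) := by
            rw [e2, add_comm Q]
            gcongr
            rw [mul_pow, e1]; nlinarith

end IsGreedyRun

end Greedy

section GreedyLimits

open Filter Topology

variable {H : Type*} [NormedAddCommGroup H] [InnerProductSpace ℂ H]

/-! ### Limits of greedy runs -/

namespace IsGreedyRun

variable {t : ℕ → ℝ} {u : ℕ → H} {k : ℕ → ℕ} {f x r : ℕ → H} {c : ℕ → ℂ} {s : ℕ → ℝ}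

theorem hasSum_of_tendsto (h : IsGreedyRun t u k f x r c s) {v : H} {a b : ℝ}
    (ha : Tendsto (fun n => ∑ i ∈ Finset.range (k n), ‖inner ℂ (u i) v‖ ^ 2) atTop (𝓝 a))
    (hb : Tendsto (fun n => ‖inner ℂ (r n) v‖ ^ 2) atTop (𝓝 b)) :
    HasSum (fun i => ‖inner ℂ (x i) v‖ ^ 2) (‖inner ℂ (r 0) v‖ ^ 2 + a - b) := by
  rw [hasSum_iff_tendsto_nat_of_nonneg fun _ => by positivity]
  refine ((ha.const_add _).sub hb).congr fun n => ?_
  have := h.sum_norm_sq_inner v n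
  linarith

theorem prod_coeff_nonneg (h : IsGreedyRun t u k f x r c s) (m j : ℕ) :
    0 ≤ ∏ i ∈ Finset.range j, s (m + i) :=
  Finset.prod_nonneg fun _ _ => (h.step _).coeff_nonneg

/-- If `∑ min (t n) (1 - t n)` diverges, an earlier residual is forgotten in the long run. -/
theorem tendsto_prod_coeff_zero (h : IsGreedyRun t u k f x r c s)
    (ht : ∀ n, 0 ≤ t n ∧ t n ≤ 1) (hdiv : ¬ Summable fun n => min (t n) (1 - t n)) (m : ℕ) :
    Tendsto (fun j => ∏ i ∈ Finset.range j, s (m + i)) atTop (𝓝 0) := by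
  have hnn : ∀ n, 0 ≤ min (t (m + n)) (1 - t (m + n)) := fun n =>
    le_min (ht _).1 (by linarith [(ht (m + n)).2])
  have hdiv' : ¬ Summable fun n => min (t (m + n)) (1 - t (m + n)) := by
    simp_rw [add_comm m]
    rwa [summable_nat_add_iff m (f := fun n => min (t n) (1 - t n))]
  have hlim := (not_summable_iff_tendsto_nat_atTop_of_nonneg hnn).1 hdiv'
  have hsq : Tendsto (fun j => (∏ i ∈ Finset.range j, s (m + i)) ^ 2) atTop (𝓝 0) := by
    refine squeeze_zero (fun _ => by positivity) (fun j => ?_)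
      (Real.tendsto_exp_neg_atTop_nhds_zero.comp hlim)
    rw [Function.comp_apply, ← Finset.sum_neg_distrib, Real.exp_sum, ← Finset.prod_pow]
    refine Finset.prod_le_prod (fun _ _ => by positivity) fun i _ => ?_
    refine (h.step (m + i)).coeff_sq_le.trans ?_
    have h1 : max (t (m + i)) (1 - t (m + i)) = 1 - min (t (m + i)) (1 - t (m + i)) := by
      rcases le_total (t (m + i)) (1 - t (m + i)) with h' | h' <;> simp [h']
    have := Real.add_one_le_exp (-min (t (m + i)) (1 - t (m + i)))
    linarith
  have := hsq.sqrt
  simpa [Real.sqrt_sq (h.prod_coeff_nonneg m _)] using this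

/-- If `∑ min (t n) (1 - t n)` diverges, the residuals tend weakly to `0`. -/
theorem tendsto_inner_residual_zero (h : IsGreedyRun t u k f x r c s)
    (ht : ∀ n, 0 ≤ t n ∧ t n ≤ 1) (hdiv : ¬ Summable fun n => min (t n) (1 - t n)) {v : H}
    (hv : Summable fun n => ‖inner ℂ (f n) v‖ ^ 2) :
    Tendsto (fun n => inner ℂ (r n) v) atTop (𝓝 0) := by
  rw [Metric.tendsto_atTop]
  intro ε hε
  obtain ⟨m, hm⟩ : ∃ m, ∑' i, ‖inner ℂ (f (i + m)) v‖ ^ 2 < (ε / 2) ^ 2 :=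
    ((tendsto_sum_nat_add fun n => ‖inner ℂ (f n) v‖ ^ 2).eventually
      (gt_mem_nhds (by positivity))).exists
  have hP := (h.tendsto_prod_coeff_zero ht hdiv m).mul_const ‖inner ℂ (r m) v‖
  rw [zero_mul] at hP
  obtain ⟨N, hN⟩ := eventually_atTop.1 (hP.eventually (gt_mem_nhds (half_pos hε)))
  refine ⟨m + N, fun n hn => ?_⟩
  obtain ⟨j, rfl⟩ := Nat.exists_eq_add_of_le (le_trans (Nat.le_add_right m N) hn)
  obtain ⟨w, hw, hb⟩ := h.exists_residual_eq m j
  have h1 := hN j (by omega)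
  have h0 := h.prod_coeff_nonneg m j
  have h2 : ‖inner ℂ w v‖ < ε / 2 := by
    refine lt_of_pow_lt_pow_left₀ 2 (by positivity) ?_
    calc _ ≤ _ := hb v
      _ ≤ 1 * ∑ i ∈ Finset.range j, ‖inner ℂ (f (m + i)) v‖ ^ 2 := by
        gcongr
        nlinarith
      _ ≤ ∑' i, ‖inner ℂ (f (i + m)) v‖ ^ 2 := by
        rw [one_mul]
        simp_rw [add_comm m]
        exact ((summable_nat_add_iff m).2 hv).sum_le_tsum _ fun _ _ => by positivity
      _ < _ := hm
  rw [dist_zero_right, hw, inner_add_left, inner_smul_left, Complex.conj_ofReal]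
  calc _ ≤ _ := norm_add_le _ _
    _ = (∏ i ∈ Finset.range j, s (m + i)) * ‖inner ℂ (r m) v‖ + ‖inner ℂ w v‖ := by
      rw [norm_mul, Complex.norm_real, Real.norm_of_nonneg h0]
    _ < ε / 2 + ε / 2 := add_lt_add h1 h2
    _ = ε := add_halves ε

theorem sum_le_count (h : IsGreedyRun t u k f x r c s) (hu : ∀ n, ‖u n‖ = 1) (n : ℕ) :
    ∑ i ∈ Finset.range n, t i ≤ ‖r 0‖ ^ 2 + k n := by
  have := h.norm_sq_residual hu n
  have := sq_nonneg ‖r n‖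
  linarith

end IsGreedyRun

/-- The carpenter construction when `∑ min (t n) (1 - t n) = ∞`: no residual remains. -/
theorem exists_hasSum_of_not_summable_min {t : ℕ → ℝ} (ht : ∀ n, 0 ≤ t n ∧ t n ≤ 1)
    (hdiv : ¬ Summable fun n => min (t n) (1 - t n)) {u : ℕ → H} (hu : ∀ n, ‖u n‖ = 1)
    {q : H → ℝ} (hq : ∀ v, HasSum (fun n => ‖inner ℂ (u n) v‖ ^ 2) (q v)) :
    ∃ x : ℕ → H, (∀ n, ‖x n‖ ^ 2 = t n) ∧
      ∀ v, HasSum (fun n => ‖inner ℂ (x n) v‖ ^ 2) (q v) := by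
  obtain ⟨k, f, x, r, c, s, h, h0⟩ :=
    exists_isGreedyRun ht hu (r₀ := (0 : H)) (by simp)
  have hts : ¬ Summable t := fun hs => hdiv <|
    hs.of_nonneg_of_le (fun n => le_min (ht n).1 (by linarith [(ht n).2]))
      fun n => min_le_left _ _
  have hk : Tendsto k atTop atTop := by
    rw [← tendsto_natCast_atTop_iff (R := ℝ)]
    refine tendsto_atTop_mono (fun n => ?_)
      ((not_summable_iff_tendsto_nat_atTop_of_nonneg fun n => (ht n).1).1 hts)
    simpa [h0] using h.sum_le_count hu n
  refine ⟨x, fun n => (h.step n).norm_sq_left, fun v => ?_⟩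
  have h1 := (hq v).tendsto_sum_nat.comp hk
  have h2 : HasSum (fun n => ‖inner ℂ (f n) v‖ ^ 2) (q v) := by
    rw [hasSum_iff_tendsto_nat_of_nonneg fun _ => by positivity]
    refine h1.congr fun n => ?_
    exact (h.sum_fresh (fun w => ‖inner ℂ w v‖ ^ 2) (by simp) n).symm
  have h3 := ((h.tendsto_inner_residual_zero ht hdiv h2.summable).norm).pow 2
  simpa [h0] using h.hasSum_of_tendsto h1 h3

/-- A residual `r₀` and `M` unit vectors, of total squared norm `M + ‖r₀‖ ^ 2 = ∑ t n`: the
residuals tend to `0` in norm. -/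
theorem exists_hasSum_nat_of_hasSum {t : ℕ → ℝ} (ht : ∀ n, 0 ≤ t n ∧ t n ≤ 1) {u : ℕ → H}
    (hu : ∀ n, ‖u n‖ = 1) {r₀ : H} (hr₀ : ‖r₀‖ ^ 2 ≤ 1) {M : ℕ}
    (hM : HasSum t (M + ‖r₀‖ ^ 2)) :
    ∃ x : ℕ → H, (∀ n, ‖x n‖ ^ 2 = t n) ∧ ∀ v, HasSum (fun n => ‖inner ℂ (x n) v‖ ^ 2)
      (‖inner ℂ r₀ v‖ ^ 2 + ∑ i ∈ Finset.range M, ‖inner ℂ (u i) v‖ ^ 2) := by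
  obtain ⟨k, f, x, r, c, s, h, h0⟩ := exists_isGreedyRun ht hu hr₀
  have hle : ∀ n, ∑ i ∈ Finset.range n, t i ≤ M + ‖r₀‖ ^ 2 := fun n =>
    sum_le_hasSum _ (fun i _ => (ht i).1) hM
  have hkM : ∀ n, k n ≤ M := by
    intro n
    induction n with
    | zero => simp [h.count_zero]
    | succ n ih =>
      rcases le_or_gt (t n) (‖r n‖ ^ 2) with h' | h'
      · rw [(h.of_le n h').1]; exact ih
      · rw [(h.of_lt n h').1]
        have h1 := h.norm_sq_residual hu n
        have h2 := hle (n + 1)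
        rw [Finset.sum_range_succ] at h2
        rw [h0] at h1
        have : (k n : ℝ) < M := by linarith
        exact_mod_cast this
  have hev : ∀ᶠ n in atTop, k n = M := by
    filter_upwards [hM.tendsto_sum_nat.eventually
      (lt_mem_nhds (show (M : ℝ) + ‖r₀‖ ^ 2 - 1 < M + ‖r₀‖ ^ 2 by linarith))] with n hn
    have h1 := h.sum_le_count hu n
    rw [h0] at h1
    have : (M : ℝ) < k n + 1 := by linarith
    have : M < k n + 1 := by exact_mod_cast this
    have := hkM n
    omega
  have hr : Tendsto (fun n => ‖r n‖ ^ 2) atTop (𝓝 0) := by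
    have h1 := (hM.tendsto_sum_nat.const_sub (M + ‖r₀‖ ^ 2))
    rw [sub_self] at h1
    refine h1.congr' ?_
    filter_upwards [hev] with n hn
    rw [h.norm_sq_residual hu n, hn, h0]
    ring
  refine ⟨x, fun n => (h.step n).norm_sq_left, fun v => ?_⟩
  have h1 : Tendsto (fun n => ∑ i ∈ Finset.range (k n), ‖inner ℂ (u i) v‖ ^ 2) atTop
      (𝓝 (∑ i ∈ Finset.range M, ‖inner ℂ (u i) v‖ ^ 2)) :=
    tendsto_const_nhds.congr' (by filter_upwards [hev] with n hn; rw [hn])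
  have h2 : Tendsto (fun n => ‖inner ℂ (r n) v‖ ^ 2) atTop (𝓝 0) := by
    have := hr.mul_const (‖v‖ ^ 2)
    rw [zero_mul] at this
    refine squeeze_zero (fun _ => by positivity) (fun n => ?_) this
    rw [← mul_pow]
    gcongr
    exact norm_inner_le_norm _ _
  simpa [h0] using h.hasSum_of_tendsto h1 h2

/-- The version of `exists_hasSum_nat_of_hasSum` for a countable index type, which may be finite:
indices outside the range of an encoding of `ι` in `ℕ` are given the target `0`. -/
theorem exists_hasSum_of_hasSum {ι : Type*} [Countable ι] {t : ι → ℝ}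
    (ht : ∀ i, 0 ≤ t i ∧ t i ≤ 1) {u : ℕ → H} (hu : ∀ n, ‖u n‖ = 1) {r₀ : H}
    (hr₀ : ‖r₀‖ ^ 2 ≤ 1) {M : ℕ} (hM : HasSum t (M + ‖r₀‖ ^ 2)) :
    ∃ x : ι → H, (∀ i, ‖x i‖ ^ 2 = t i) ∧ ∀ v, HasSum (fun i => ‖inner ℂ (x i) v‖ ^ 2)
      (‖inner ℂ r₀ v‖ ^ 2 + ∑ i ∈ Finset.range M, ‖inner ℂ (u i) v‖ ^ 2) := by
  obtain ⟨g, hg⟩ := exists_injective_nat ι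
  have hT : ∀ n, 0 ≤ Function.extend g t 0 n ∧ Function.extend g t 0 n ≤ 1 := by
    intro n
    by_cases hn : ∃ i, g i = n
    · obtain ⟨i, rfl⟩ := hn
      rw [hg.extend_apply]; exact ht i
    · rw [Function.extend_apply' _ _ _ hn]; simp
  obtain ⟨x, hx, hs⟩ := exists_hasSum_nat_of_hasSum hT hu hr₀
    ((hasSum_extend_zero hg).2 hM)
  refine ⟨fun i => x (g i), fun i => by rw [hx, hg.extend_apply], fun v => ?_⟩
  refine (hg.hasSum_iff (f := fun n => ‖inner ℂ (x n) v‖ ^ 2) fun n hn => ?_).2 (hs v)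
  have : x n = 0 := by
    have := hx n
    rw [Function.extend_apply' _ _ _ hn] at this
    simpa using this
  simp [this]

theorem one_sub_sum_le_prod_one_sub {a : ℕ → ℝ} (ha : ∀ i, 0 ≤ a i ∧ a i ≤ 1) (n : ℕ) :
    1 - ∑ i ∈ Finset.range n, a i ≤ ∏ i ∈ Finset.range n, (1 - a i) := by
  induction n with
  | zero => simp
  | succ n ih =>
    rw [Finset.sum_range_succ, Finset.prod_range_succ]
    have h1 : ∏ i ∈ Finset.range n, (1 - a i) ≤ 1 :=
      Finset.prod_le_one (fun i _ => by linarith [(ha i).2]) fun i _ => by linarith [(ha i).1]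
    nlinarith [(ha n).1]

/-- If every unit vector `u n` gives up a part of total `∑ (1 - t n) = β < 1`, the parts given up
accumulate in a residual that converges in norm, to a vector `r` with `‖r‖ ^ 2 = β`. -/
theorem exists_hasSum_add_residual [CompleteSpace H] {t : ℕ → ℝ}
    (ht : ∀ n, 0 ≤ t n ∧ t n ≤ 1) {β : ℝ} (hβ : β < 1) (hsum : HasSum (fun n => 1 - t n) β)
    {u : ℕ → H} (hu : ∀ n, ‖u n‖ = 1) {q : H → ℝ}
    (hq : ∀ v, HasSum (fun n => ‖inner ℂ (u n) v‖ ^ 2) (q v)) {C : ℝ} (hC : 0 ≤ C)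
    (hqC : ∀ v, q v ≤ C * ‖v‖ ^ 2) :
    ∃ (x : ℕ → H) (r : H), (∀ n, ‖x n‖ ^ 2 = t n) ∧ ‖r‖ ^ 2 = β ∧
      ∀ v, HasSum (fun n => ‖inner ℂ (x n) v‖ ^ 2) (q v - ‖inner ℂ r v‖ ^ 2) := by
  obtain ⟨k, f, x, r, c, s, h, h0⟩ :=
    exists_isGreedyRun ht hu (r₀ := (0 : H)) (by simp)
  have hle : ∀ n, ∑ i ∈ Finset.range n, (1 - t i) ≤ β := fun n =>
    sum_le_hasSum _ (fun i _ => by linarith [(ht i).2]) hsum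
  have hres : ∀ n, k n = n → ‖r n‖ ^ 2 = ∑ i ∈ Finset.range n, (1 - t i) := by
    intro n hn
    rw [h.norm_sq_residual hu n, hn, h0]
    simp
  have hlt : ∀ n, k n = n → ‖r n‖ ^ 2 < t n := by
    intro n hn
    have := hle (n + 1)
    rw [Finset.sum_range_succ, ← hres n hn] at this
    linarith
  have hk : ∀ n, k n = n := by
    intro n
    induction n with
    | zero => exact h.count_zero
    | succ n ih => rw [(h.of_lt n (hlt n ih)).1, ih]
  have hf : ∀ n, f n = u n := fun n => by
    have := (h.of_lt n (hlt n (hk n))).2.1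
    rwa [hk] at this
  have hβ0 : 0 < 1 - β := by linarith
  -- The coefficients `c n` are square summable, by comparison with `1 - t n`.
  have hc : Summable fun n => ‖c n‖ ^ 2 := by
    refine (hsum.summable.mul_left (1 - β)⁻¹).of_nonneg_of_le (fun _ => by positivity)
      fun n => ?_
    have h1 := (h.of_lt n (hlt n (hk n))).2.2.2
    have h2 : ‖r n‖ ^ 2 ≤ β := by rw [hres n (hk n)]; exact hle n
    rw [inv_mul_eq_div, le_div_iff₀ hβ0, ← h1]
    gcongr
  set τ : ℕ → ℝ := fun m => ∑' i, ‖c (i + m)‖ ^ 2 with hτ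
  have hτlim : Tendsto τ atTop (𝓝 0) := tendsto_sum_nat_add fun n => ‖c n‖ ^ 2
  have hτ0 : ∀ m, 0 ≤ τ m := fun m => tsum_nonneg fun _ => by positivity
  have hdist : ∀ m j, ‖r (m + j) - r m‖ ≤ τ m + √(τ m * C) := by
    intro m j
    obtain ⟨w, hw, hb⟩ := h.exists_residual_eq m j
    have hP0 := h.prod_coeff_nonneg m j
    have hPτ : 1 - (∏ i ∈ Finset.range j, s (m + i)) ^ 2 ≤ τ m := by
      have h1 : (∏ i ∈ Finset.range j, s (m + i)) ^ 2
          = ∏ i ∈ Finset.range j, (1 - ‖c (m + i)‖ ^ 2) := by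
        rw [← Finset.prod_pow]
        refine Finset.prod_congr rfl fun i _ => ?_
        linarith [(h.of_lt (m + i) (hlt _ (hk _))).2.2.1]
      have h2 := one_sub_sum_le_prod_one_sub (a := fun i => ‖c (m + i)‖ ^ 2)
        (fun i => ⟨by positivity, by
          nlinarith [(h.step (m + i)).coeff_sq_add_sq_le, sq_nonneg (s (m + i))]⟩) j
      have h3 : ∑ i ∈ Finset.range j, ‖c (m + i)‖ ^ 2 ≤ τ m := by
        simp_rw [add_comm m]
        exact ((summable_nat_add_iff m).2 hc).sum_le_tsum _ fun _ _ => by positivity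
      rw [h1]; linarith
    have hP1 : ∏ i ∈ Finset.range j, s (m + i) ≤ 1 := by
      refine Finset.prod_le_one (fun i _ => (h.step _).coeff_nonneg) fun i _ => ?_
      refine (sq_le_one_iff₀ (h.step _).coeff_nonneg).1 ?_
      nlinarith [(h.step (m + i)).coeff_sq_add_sq_le, sq_nonneg ‖c (m + i)‖]
    have hwn : ‖w‖ ^ 2 ≤ τ m * C := by
      have h1 : ‖w‖ ^ 2 * ‖w‖ ^ 2 ≤ τ m * C * ‖w‖ ^ 2 := by
        calc ‖w‖ ^ 2 * ‖w‖ ^ 2 = ‖inner ℂ w w‖ ^ 2 := by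
              rw [inner_self_eq_norm_sq_to_K]; simp; ring
          _ ≤ _ := hb w
          _ ≤ τ m * (C * ‖w‖ ^ 2) := by
            refine mul_le_mul hPτ ?_ (Finset.sum_nonneg fun _ _ => by positivity) (hτ0 m)
            refine le_trans ?_ (hqC w)
            simp_rw [hf, add_comm m]
            rw [← (hq w).tsum_eq, ← (hq w).summable.sum_add_tsum_nat_add m]
            refine le_add_of_nonneg_of_le (Finset.sum_nonneg fun _ _ => by positivity) ?_
            exact ((summable_nat_add_iff m).2 (hq w).summable).sum_le_tsum _
              fun _ _ => by positivity
          _ = _ := by ring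
      rcases (norm_nonneg w).eq_or_lt with h0 | h0
      · rw [← h0]
        simpa using mul_nonneg (hτ0 m) hC
      · exact le_of_mul_le_mul_right h1 (by positivity)
    have hr1 : ‖r m‖ ≤ 1 := (sq_le_one_iff₀ (norm_nonneg _)).1 (h.norm_sq_le_one m)
    have h2 : r (m + j) - r m
        = ((∏ i ∈ Finset.range j, s (m + i) - 1 : ℝ) : ℂ) • r m + w := by
      rw [hw]; push_cast; rw [sub_smul, one_smul]; abel
    rw [h2]
    refine (norm_add_le _ _).trans (add_le_add ?_ (Real.le_sqrt_of_sq_le hwn))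
    rw [norm_smul, Complex.norm_real, Real.norm_eq_abs, abs_sub_comm, abs_of_nonneg (by linarith)]
    nlinarith [norm_nonneg (r m)]
  have hlim0 : Tendsto (fun m => τ m + √(τ m * C)) atTop (𝓝 0) := by
    simpa using hτlim.add (hτlim.mul_const C).sqrt
  have hcauchy : CauchySeq r := by
    rw [Metric.cauchySeq_iff']
    intro ε hε
    obtain ⟨m, hm⟩ := (hlim0.eventually (gt_mem_nhds hε)).exists
    refine ⟨m, fun n hn => ?_⟩
    obtain ⟨j, rfl⟩ := Nat.exists_eq_add_of_le hn
    rw [dist_eq_norm]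
    exact (hdist m j).trans_lt hm
  obtain ⟨r', hr'⟩ := cauchySeq_tendsto_of_complete hcauchy
  refine ⟨x, r', fun n => (h.step n).norm_sq_left, ?_, fun v => ?_⟩
  · refine tendsto_nhds_unique (hr'.norm.pow 2) (hsum.tendsto_sum_nat.congr fun n => ?_)
    rw [hres n (hk n)]
  · have h1 : Tendsto (fun n => ∑ i ∈ Finset.range (k n), ‖inner ℂ (u i) v‖ ^ 2) atTop
        (𝓝 (q v)) := by simpa only [hk] using (hq v).tendsto_sum_nat
    have h2 : Tendsto (fun n => ‖inner ℂ (r n) v‖ ^ 2) atTop (𝓝 (‖inner ℂ r' v‖ ^ 2)) :=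
      ((hr'.inner tendsto_const_nhds).norm).pow 2
    simpa [h0] using h.hasSum_of_tendsto h1 h2

end GreedyLimits

/-! ### Operators and families of vectors -/

section Operators

open Filter Topology

variable {H : Type*} [NormedAddCommGroup H] [InnerProductSpace ℂ H]

theorem HilbertBasis.hasSum_norm_sq_inner {κ : Type*} (b : HilbertBasis κ ℂ H) (x : H) :
    HasSum (fun i => ‖inner ℂ (b i) x‖ ^ 2) (‖x‖ ^ 2) := by
  have h := Complex.hasSum_re (b.hasSum_inner_mul_inner x x)
  convert h using 1
  · ext i
    rw [← inner_conj_symm x (b i), Complex.conj_mul']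
    norm_cast
  · rw [inner_self_eq_norm_sq_to_K]
    norm_cast

theorem Orthonormal.countable [TopologicalSpace.SeparableSpace H] {κ : Type*} {w : κ → H}
    (hw : Orthonormal ℂ w) : Countable κ := by
  refine Pairwise.countable_of_isOpen_disjoint (s := fun i => Metric.ball (w i) (1 / 2))
    (fun i j hij => ?_) (fun _ => Metric.isOpen_ball)
    (fun i => ⟨w i, Metric.mem_ball_self (by norm_num)⟩)
  refine Metric.ball_disjoint_ball ?_
  have h : dist (w i) (w j) ^ 2 = 2 := by
    rw [dist_eq_norm, @norm_sub_sq ℂ, hw.2 hij, hw.1, hw.1]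
    norm_num
  nlinarith [dist_nonneg (x := w i) (y := w j)]

theorem IsStarProjection.exists_unit_family [CompleteSpace H]
    [TopologicalSpace.SeparableSpace H] {E : H →L[ℂ] H} (hE : IsStarProjection E) :
    ∃ s : Set H, Countable s ∧ (∀ w : s, ‖(w : H)‖ = 1) ∧
      ∀ v, HasSum (fun w : s => ‖inner ℂ (w : H) v‖ ^ 2) (inner ℂ (E v) v).re := by
  have hsym : ∀ x y, inner ℂ (E x) y = inner ℂ x (E y) := fun x y =>
    (ContinuousLinearMap.isSelfAdjoint_iff_isSymmetric.1 hE.isSelfAdjoint) x y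
  have hidem : ∀ x, E (E x) = E x := fun x => DFunLike.congr_fun hE.isIdempotentElem x
  let U : Submodule ℂ H := (E : H →ₗ[ℂ] H).range
  have hcl : IsClosed (U : Set H) := by
    have : (U : Set H) = {x | E x = x} := by
      ext x
      exact ⟨fun ⟨y, hy⟩ => by rw [← hy]; exact hidem y, fun hx => ⟨x, hx⟩⟩
    rw [this]
    exact isClosed_eq E.continuous continuous_id
  have : CompleteSpace U := hcl.completeSpace_coe
  obtain ⟨w, b, hb⟩ := exists_hilbertBasis ℂ U
  have hon : Orthonormal ℂ (fun i : w => ((i : U) : H)) := by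
    have := b.orthonormal
    rw [hb] at this
    exact this.comp_linearIsometry U.subtypeₗᵢ
  have hcount : Countable w := hon.countable
  have hinj : Function.Injective (fun i : w => ((i : U) : H)) :=
    Subtype.val_injective.comp Subtype.val_injective
  refine ⟨Set.range fun i : w => ((i : U) : H), Set.countable_range _, ?_, fun v => ?_⟩
  · rintro ⟨_, i, rfl⟩
    exact hon.1 i
  · rw [← (Equiv.ofInjective _ hinj).hasSum_iff]
    have h := b.hasSum_norm_sq_inner ⟨E v, v, rfl⟩
    rw [hb] at h
    convert h using 1
    · ext i
      have hi : E ((i : U) : H) = (i : U) := by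
        obtain ⟨y, hy⟩ := (i : U).2
        rw [← hy]; exact hidem y
      change ‖inner ℂ ((i : U) : H) v‖ ^ 2 = ‖inner ℂ ((i : U) : H) (E v)‖ ^ 2
      rw [← hsym, hi]
    · change _ = ‖E v‖ ^ 2
      have h1 : inner ℂ (E v) v = inner ℂ (E v) (E v) := by
        rw [hsym v, hsym v, hidem]
      rw [h1, inner_self_eq_norm_sq_to_K]
      norm_cast

theorem IsSumOfProjections.isPositive [CompleteSpace H] {A : H →L[ℂ] H}
    (hA : IsSumOfProjections A) :
    A.IsPositive := by
  obtain ⟨E, hE, hlim⟩ := hA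
  rw [ContinuousLinearMap.isPositive_iff_complex]
  intro v
  have h1 : Tendsto (fun n => inner ℂ ((∑ j ∈ Finset.range n, E j) v) v) atTop
      (𝓝 (inner ℂ (A v) v)) := by
    simp only [sum_apply]
    exact (hlim v).inner tendsto_const_nhds
  have h2 : ∀ n, (∑ j ∈ Finset.range n, E j).IsPositive := fun n =>
    ContinuousLinearMap.isPositive_sum _ fun j _ =>
      ContinuousLinearMap.IsPositive.of_isStarProjection (hE j)
  have h3 : Tendsto (fun n => (inner ℂ ((∑ j ∈ Finset.range n, E j) v) v).re) atTop
      (𝓝 (inner ℂ (A v) v).re) := (Complex.continuous_re.tendsto _).comp h1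
  refine ⟨tendsto_nhds_unique
    (((Complex.continuous_ofReal.tendsto _).comp h3).congr fun n => ?_) h1,
    ge_of_tendsto' h3 fun n => (h2 n).re_inner_nonneg_left v⟩
  exact (((ContinuousLinearMap.isPositive_iff_complex _).1 (h2 n)) v).1

/-- A sum of projections is, as a quadratic form, a sum of rank-one projections. -/
theorem IsSumOfProjections.exists_unit_family [CompleteSpace H] [TopologicalSpace.SeparableSpace H]
    {A : H →L[ℂ] H} (hA : IsSumOfProjections A) :
    ∃ s : ℕ → Set H, (∀ n, Countable (s n)) ∧ (∀ p : Σ n, s n, ‖(p.2 : H)‖ = 1) ∧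
      ∀ v, HasSum (fun p : Σ n, s n => ‖inner ℂ (p.2 : H) v‖ ^ 2) (inner ℂ (A v) v).re := by
  obtain ⟨E, hE, hlim⟩ := hA
  choose s hc hn hs using fun j => (hE j).exists_unit_family
  refine ⟨s, hc, fun p => hn _ _, fun v => ?_⟩
  have h1 : HasSum (fun j => (inner ℂ (E j v) v).re) (inner ℂ (A v) v).re := by
    have h0 : ∀ j, 0 ≤ (inner ℂ (E j v) v).re := fun j =>
      (ContinuousLinearMap.IsPositive.of_isStarProjection (hE j)).re_inner_nonneg_left v
    rw [hasSum_iff_tendsto_nat_of_nonneg h0]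
    refine ((Complex.continuous_re.tendsto _).comp
      ((hlim v).inner (tendsto_const_nhds (x := v)))).congr fun n => ?_
    simp [sum_inner]
  refine HasSum.sigma_of_hasSum h1 (fun j => hs j v) ?_
  refine (summable_sigma_of_nonneg fun _ => by positivity).2
    ⟨fun j => (hs j v).summable, ?_⟩
  exact h1.summable.congr fun j => (hs j v).tsum_eq.symm

theorem positiveTrace_eq_tsum_norm_sq {κ : Type*} (e : HilbertBasis κ ℂ H) {A : H →L[ℂ] H}
    (hA : A.IsPositive) {K : Type*} {w : K → H}
    (hw : ∀ v, HasSum (fun i => ‖inner ℂ (w i) v‖ ^ 2) (inner ℂ (A v) v).re) :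
    positiveTrace e A = ∑' i, ENNReal.ofReal (‖w i‖ ^ 2) := by
  have h1 : ∀ k, ENNReal.ofReal (inner ℂ (e k) (A (e k))).re
      = ∑' i, ENNReal.ofReal (‖inner ℂ (w i) (e k)‖ ^ 2) := fun k => by
    rw [← hA.inner_left_eq_inner_right, ← (hw (e k)).tsum_eq,
      ENNReal.ofReal_tsum_of_nonneg (fun _ => by positivity) (hw _).summable]
  have h2 : ∀ i, ENNReal.ofReal (‖w i‖ ^ 2)
      = ∑' k, ENNReal.ofReal (‖inner ℂ (w i) (e k)‖ ^ 2) := fun i => by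
    have h := e.hasSum_norm_sq_inner (w i)
    simp_rw [norm_inner_symm (w i)]
    rw [← h.tsum_eq, ENNReal.ofReal_tsum_of_nonneg (fun _ => by positivity) h.summable]
  simp_rw [positiveTrace, h1, h2]
  exact ENNReal.tsum_comm

theorem ContinuousLinearMap.IsPositive.norm_sq_apply_le {T : H →L[ℂ] H} (hT : T.IsPositive)
    {C : ℝ} (hC : 0 < C) (hTC : ∀ w, (inner ℂ (T w) w).re ≤ C * ‖w‖ ^ 2) (v : H) :
    ‖T v‖ ^ 2 ≤ C * (inner ℂ (T v) v).re := by
  -- Positivity at `v - C⁻¹ • T v` gives the bound.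
  have h := hT.re_inner_nonneg_left (v - ((C⁻¹ : ℝ) : ℂ) • T v)
  have h1 : inner ℂ (T (T v)) v = inner ℂ (T v) (T v) := hT.inner_left_eq_inner_right _ _
  have h2 : (inner ℂ (T v) (T v)).re = ‖T v‖ ^ 2 := by
    rw [inner_self_eq_norm_sq_to_K]; norm_cast
  have h3 := hTC (T v)
  simp only [map_sub, map_smul, inner_sub_left, inner_sub_right, inner_smul_left,
    inner_smul_right, h1, Complex.conj_ofReal, RCLike.re_to_complex, Complex.sub_re,
    Complex.re_ofReal_mul, h2] at h
  have h4 : C⁻¹ * (C⁻¹ * (inner ℂ (T (T v)) (T v)).re) ≤ C⁻¹ * ‖T v‖ ^ 2 := by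
    gcongr
    rw [inv_mul_le_iff₀ hC]; exact h3
  have h5 : C⁻¹ * ‖T v‖ ^ 2 ≤ (inner ℂ (T v) v).re := by linarith
  rwa [inv_mul_le_iff₀ hC] at h5

theorem ContinuousLinearMap.re_inner_apply_le (A : H →L[ℂ] H) (v : H) :
    (inner ℂ (A v) v).re ≤ ‖A‖ * ‖v‖ ^ 2 :=
  calc (inner ℂ (A v) v).re ≤ ‖A v‖ * ‖v‖ := re_inner_le_norm (𝕜 := ℂ) _ _
    _ ≤ ‖A‖ * ‖v‖ * ‖v‖ := by gcongr; exact A.le_opNorm v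
    _ = ‖A‖ * ‖v‖ ^ 2 := by ring

/-- For positive operators, weak convergence of a sum of rank-one operators to `A` implies
strong convergence: the remainders are positive and bounded by `A`, so `‖D v‖ ^ 2` is controlled by
`⟪D v, v⟫` for each remainder `D`. -/
theorem ContinuousLinearMap.IsPositive.hasSum_inner_smul [CompleteSpace H]
    {A : H →L[ℂ] H} (hA : A.IsPositive)
    {ι : Type*} {x : ι → H}
    (hx : ∀ v, HasSum (fun i => ‖inner ℂ (x i) v‖ ^ 2) (inner ℂ (A v) v).re) (v : H) :
    HasSum (fun i => inner ℂ (x i) v • x i) (A v) := by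
  let D : Finset ι → H →L[ℂ] H := fun F => A - ∑ i ∈ F, InnerProductSpace.rankOne ℂ (x i) (x i)
  have hD : ∀ F v, inner ℂ (D F v) v
      = inner ℂ (A v) v - ((∑ i ∈ F, ‖inner ℂ (x i) v‖ ^ 2 : ℝ) : ℂ) := by
    intro F v
    simp only [D, sub_apply, sum_apply, inner_sub_left,
      sum_inner, InnerProductSpace.rankOne_apply, inner_smul_left, Complex.conj_mul']
    push_cast
    rfl
  have hA' := (ContinuousLinearMap.isPositive_iff_complex _).1 hA
  have hDpos : ∀ F, (D F).IsPositive := by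
    intro F
    rw [ContinuousLinearMap.isPositive_iff_complex]
    intro v
    rw [hD]
    constructor
    · rw [RCLike.re_to_complex, Complex.sub_re, Complex.ofReal_re, Complex.ofReal_sub]
      exact congrArg (· - _) (hA' v).1
    · simp only [RCLike.re_to_complex, Complex.sub_re, Complex.ofReal_re, sub_nonneg]
      exact sum_le_hasSum _ (fun _ _ => by positivity) (hx v)
  have hle : ∀ F w, (inner ℂ (D F w) w).re ≤ (‖A‖ + 1) * ‖w‖ ^ 2 := by
    intro F w
    rw [hD, Complex.sub_re, Complex.ofReal_re]
    have h1 := A.re_inner_apply_le w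
    have h2 : 0 ≤ ∑ i ∈ F, ‖inner ℂ (x i) w‖ ^ 2 := Finset.sum_nonneg fun _ _ => by positivity
    nlinarith [sq_nonneg ‖w‖]
  have hsq : Tendsto (fun F => ‖D F v‖ ^ 2) atTop (𝓝 0) := by
    have h1 : Tendsto (fun F : Finset ι => (‖A‖ + 1) *
        ((inner ℂ (A v) v).re - ∑ i ∈ F, ‖inner ℂ (x i) v‖ ^ 2)) atTop (𝓝 0) := by
      have := ((hx v).const_sub (inner ℂ (A v) v).re).const_mul (‖A‖ + 1)
      rwa [sub_self, mul_zero] at this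
    refine squeeze_zero (fun _ => by positivity) (fun F => ?_) h1
    have := (hDpos F).norm_sq_apply_le (by positivity) (hle F) v
    rwa [hD, Complex.sub_re, Complex.ofReal_re] at this
  have hD0 : Tendsto (fun F => D F v) atTop (𝓝 0) := by
    rw [tendsto_zero_iff_norm_tendsto_zero]
    simpa [Real.sqrt_sq] using hsq.sqrt
  have := hD0.const_sub (A v)
  rw [sub_zero] at this
  refine this.congr fun F => ?_
  simp [D]

theorem isRankOneProjection_rankOne [CompleteSpace H] {u : H} (hu : ‖u‖ = 1) :
    IsRankOneProjection (InnerProductSpace.rankOne ℂ u u) := by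
  refine ⟨InnerProductSpace.isStarProjection_rankOne_self hu, ?_⟩
  have hu0 : u ≠ 0 := by rintro rfl; simp at hu
  have : (InnerProductSpace.rankOne ℂ u u : H →ₗ[ℂ] H).range = Submodule.span ℂ {u} := by
    ext y
    rw [Submodule.mem_span_singleton]
    constructor
    · rintro ⟨z, rfl⟩
      exact ⟨inner ℂ u z, rfl⟩
    · rintro ⟨c, rfl⟩
      refine ⟨c • u, ?_⟩
      simp [inner_self_eq_norm_sq_to_K, hu]
  rw [this]
  exact finrank_span_singleton hu0

/-- It suffices to write the quadratic form of `A` as a sum over vectors with the prescribed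
norms; a vector `0` leaves the choice of the projection free. -/
theorem isAdmissible_of_hasSum [CompleteSpace H] [Nontrivial H] {A : H →L[ℂ] H}
    (hA : A.IsPositive) {ι : Type*}
    {ξ : ι → ℝ} {x : ι → H} (hxn : ∀ i, ‖x i‖ ^ 2 = ξ i)
    (hx : ∀ v, HasSum (fun i => ‖inner ℂ (x i) v‖ ^ 2) (inner ℂ (A v) v).re) :
    IsAdmissible ξ A := by
  have key : ∀ i, ∃ u : H, ‖u‖ = 1 ∧ x i = (‖x i‖ : ℂ) • u := by
    intro i
    by_cases h : x i = 0
    · obtain ⟨u, hu⟩ := exists_norm_eq H zero_le_one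
      exact ⟨u, hu, by simp [h]⟩
    · refine ⟨((‖x i‖⁻¹ : ℝ) : ℂ) • x i, ?_, ?_⟩
      · rw [norm_smul, Complex.norm_real, norm_inv, norm_norm,
          inv_mul_cancel₀ (norm_ne_zero_iff.2 h)]
      · rw [smul_smul, ← Complex.ofReal_mul, mul_inv_cancel₀ (norm_ne_zero_iff.2 h)]
        simp
  choose u hu hxu using key
  refine ⟨fun i => InnerProductSpace.rankOne ℂ (u i) (u i),
    fun i => isRankOneProjection_rankOne (hu i), fun v => ?_⟩
  convert hA.hasSum_inner_smul hx v using 2 with i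
  rw [InnerProductSpace.rankOne_apply, ← hxn i]
  conv_rhs => rw [hxu i]
  rw [inner_smul_left, smul_smul, smul_smul, Complex.conj_ofReal, Complex.ofReal_pow]
  congr 1
  ring

end Operators

/-! ### The Kadison condition -/

section Kadison

open Filter Topology

variable {H : Type*} [NormedAddCommGroup H] [InnerProductSpace ℂ H] {ι : Type*} {ξ : ι → ℝ}

theorem summable_of_tsum_ofReal_ne_top {f : ι → ℝ} (hf : ∀ i, 0 ≤ f i)
    (h : ∑' i, ENNReal.ofReal (f i) ≠ ∞) : Summable f := by
  have := ENNReal.summable_toReal h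
  simpa only [ENNReal.toReal_ofReal (hf _)] using this

theorem hasSum_toReal_tsum_ofReal {f : ι → ℝ} (hf : ∀ i, 0 ≤ f i)
    (h : ∑' i, ENNReal.ofReal (f i) ≠ ∞) :
    HasSum f (∑' i, ENNReal.ofReal (f i)).toReal := by
  have hs := summable_of_tsum_ofReal_ne_top hf h
  rw [← ENNReal.ofReal_tsum_of_nonneg hf hs, ENNReal.toReal_ofReal (tsum_nonneg hf)]
  exact hs.hasSum

theorem not_summable_min_of_add_eq_top
    (h : (∑' i : {i // ξ i ≤ 1 / 2}, ENNReal.ofReal (ξ i)) +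
        (∑' i : {i // 1 / 2 < ξ i}, ENNReal.ofReal (1 - ξ i)) = ∞) :
    ¬ Summable fun i => min (ξ i) (1 - ξ i) := by
  intro hs
  have h1 : Summable fun i : {i // ξ i ≤ 1 / 2} => ξ i :=
    (hs.comp_injective (Subtype.val_injective (p := fun i => ξ i ≤ 1 / 2))).congr fun i =>
      min_eq_left (by linarith [i.2])
  have h2 : Summable fun i : {i // 1 / 2 < ξ i} => 1 - ξ i :=
    (hs.comp_injective (Subtype.val_injective (p := fun i => 1 / 2 < ξ i))).congr fun i =>
      min_eq_right (by linarith [i.2])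
  exact ENNReal.add_ne_top.2 ⟨h1.tsum_ofReal_ne_top, h2.tsum_ofReal_ne_top⟩ h

theorem exists_hasSum_of_not_summable_min_of_countable [Countable ι] (hξ : ∀ i, 0 ≤ ξ i ∧ ξ i ≤ 1)
    (hdiv : ¬ Summable fun i => min (ξ i) (1 - ξ i)) {u : ℕ → H} (hu : ∀ n, ‖u n‖ = 1)
    {q : H → ℝ} (hq : ∀ v, HasSum (fun n => ‖inner ℂ (u n) v‖ ^ 2) (q v)) :
    ∃ x : ι → H, (∀ i, ‖x i‖ ^ 2 = ξ i) ∧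
      ∀ v, HasSum (fun i => ‖inner ℂ (x i) v‖ ^ 2) (q v) := by
  have hinf : Infinite ι := by
    by_contra hfin
    rw [not_infinite_iff_finite] at hfin
    exact hdiv Summable.of_finite
  obtain ⟨g⟩ : Nonempty (ℕ ≃ ι) := nonempty_equiv_of_countable
  obtain ⟨x, hx, hs⟩ := exists_hasSum_of_not_summable_min (fun n => hξ (g n))
    (fun h => hdiv ((g.summable_iff (f := fun i => min (ξ i) (1 - ξ i))).1 h)) hu hq
  refine ⟨fun i => x (g.symm i), fun i => by rw [hx, g.apply_symm_apply], fun v => ?_⟩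
  exact (g.symm.hasSum_iff (f := fun n => ‖inner ℂ (x n) v‖ ^ 2)).2 (hs v)

/-- The convergent case. All but finitely many of the large terms are produced from their own unit
vectors, at the cost of a residual of squared norm `β < 1`; integrality of `a - b` says that the
remaining terms have total `M + β` with `M` a natural number, so they can be produced from that
residual and `M` unit vectors set aside at the beginning. -/
theorem exists_hasSum_of_tsum_ne_top [CompleteSpace H] [Countable ι]
    (hξ : ∀ i, 0 ≤ ξ i ∧ ξ i ≤ 1) (hns : ¬ Summable ξ)
    (ha : ∑' i : {i // ξ i ≤ 1 / 2}, ENNReal.ofReal (ξ i) ≠ ∞)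
    (hb : ∑' i : {i // 1 / 2 < ξ i}, ENNReal.ofReal (1 - ξ i) ≠ ∞) {m : ℤ}
    (hm : (∑' i : {i // ξ i ≤ 1 / 2}, ENNReal.ofReal (ξ i)).toReal -
      (∑' i : {i // 1 / 2 < ξ i}, ENNReal.ofReal (1 - ξ i)).toReal = m)
    {u : ℕ → H} (hu : ∀ n, ‖u n‖ = 1)
    {q : H → ℝ} (hq : ∀ v, HasSum (fun n => ‖inner ℂ (u n) v‖ ^ 2) (q v)) {C : ℝ} (hC : 0 ≤ C)
    (hqC : ∀ v, q v ≤ C * ‖v‖ ^ 2) :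
    ∃ x : ι → H, (∀ i, ‖x i‖ ^ 2 = ξ i) ∧
      ∀ v, HasSum (fun i => ‖inner ℂ (x i) v‖ ^ 2) (q v) := by
  classical
  have hA := hasSum_toReal_tsum_ofReal (fun i : {i // ξ i ≤ 1 / 2} => (hξ i).1) ha
  have hB := hasSum_toReal_tsum_ofReal (f := fun i : {i // 1 / 2 < ξ i} => 1 - ξ i)
    (fun i => by linarith [(hξ i).2]) hb
  set a := (∑' i : {i // ξ i ≤ 1 / 2}, ENNReal.ofReal (ξ i)).toReal
  set b := (∑' i : {i // 1 / 2 < ξ i}, ENNReal.ofReal (1 - ξ i)).toReal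
  set S : Set ι := {i | ξ i ≤ 1 / 2} with hS
  have hA' : HasSum (S.indicator ξ) a := (hasSum_subtype_iff_indicator (s := S)).1 hA
  have hinf : Infinite {i // 1 / 2 < ξ i} := by
    by_contra hfin
    rw [not_infinite_iff_finite] at hfin
    refine hns (summable_subtype_and_compl (s := S).1 ⟨hA.summable, ?_⟩)
    have : Finite ↑(Sᶜ) := by
      have h : Sᶜ = {i | 1 / 2 < ξ i} := by ext i; simp [hS]
      rw [h]; exact hfin
    exact Summable.of_finite
  obtain ⟨g⟩ : Nonempty (ℕ ≃ {i // 1 / 2 < ξ i}) := nonempty_equiv_of_countable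
  have hB' : HasSum (fun n => 1 - ξ (g n)) b := (g.hasSum_iff
    (f := fun i : {i // 1 / 2 < ξ i} => 1 - ξ i)).2 hB
  have hginj : Function.Injective fun n => (g n : ι) := Subtype.val_injective.comp g.injective
  have hgS : ∀ n, (g n : ι) ∉ S := fun n h => absurd (g n).2 (not_lt.2 h)
  have hcases : ∀ i, i ∈ S ∨ ∃ n, (g n : ι) = i := fun i => by
    rcases le_or_gt (ξ i) (1 / 2) with h | h
    · exact Or.inl h
    · exact Or.inr ⟨g.symm ⟨i, h⟩, by simp⟩
  obtain ⟨n₀, hn₀⟩ : ∃ n₀, b - ∑ n ∈ Finset.range n₀, (1 - ξ (g n)) < 1 := by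
    have := hB'.tendsto_sum_nat.const_sub b
    rw [sub_self] at this
    exact (this.eventually (gt_mem_nhds one_pos)).exists
  have hβ := (hasSum_nat_add_iff' n₀).2 hB'
  set β := b - ∑ n ∈ Finset.range n₀, (1 - ξ (g n)) with hβdef
  have hβ0 : 0 ≤ β := hβ.nonneg fun n => by linarith [(hξ (g (n + n₀))).2]
  -- The targets left over: the small terms and the first `n₀` large ones.
  let tL : ℕ → ℝ := fun n => if n < n₀ then ξ (g n) else 0
  let t : ι → ℝ := fun i => S.indicator ξ i + Function.extend (fun n => (g n : ι)) tL 0 i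
  have htS : ∀ i ∈ S, t i = ξ i := fun i hi => by
    have : ¬ ∃ n, (g n : ι) = i := by rintro ⟨n, rfl⟩; exact hgS n hi
    simp only [t, Set.indicator_of_mem hi, Function.extend_apply' _ _ _ this]
    simp
  have htg : ∀ n, t (g n) = tL n := fun n => by
    simp only [t, Set.indicator_of_notMem (hgS n), zero_add]
    exact hginj.extend_apply _ _ _
  have ht : ∀ i, 0 ≤ t i ∧ t i ≤ 1 := fun i => by
    rcases hcases i with h | ⟨n, rfl⟩
    · rw [htS i h]; exact hξ i
    · rw [htg n]
      by_cases h : n < n₀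
      · simp only [tL, if_pos h]; exact hξ _
      · simp [tL, if_neg h]
  have htL : HasSum tL (n₀ - (b - β)) := by
    have h1 : HasSum tL (∑ n ∈ Finset.range n₀, tL n) :=
      hasSum_sum_of_ne_finset_zero fun n hn => if_neg (by simpa using hn)
    convert h1 using 1
    rw [hβdef, sub_sub_cancel, Finset.sum_sub_distrib, Finset.sum_const, Finset.card_range,
      nsmul_one, sub_sub_cancel]
    exact Finset.sum_congr rfl fun n hn => (if_pos (Finset.mem_range.1 hn)).symm
  have htsum : HasSum t (a + (n₀ - (b - β))) := hA'.add ((hasSum_extend_zero hginj).2 htL)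
  obtain ⟨M, hM⟩ : ∃ M : ℕ, m + n₀ = M := by
    refine Int.eq_ofNat_of_zero_le ?_
    have h1 : 0 ≤ a + (n₀ - (b - β)) := htsum.nonneg fun i => (ht i).1
    have h2 : ((-1 : ℤ) : ℝ) < ((m + n₀ : ℤ) : ℝ) := by push_cast; linarith
    have h3 : -1 < m + (n₀ : ℤ) := by exact_mod_cast h2
    omega
  have hM' : a + (n₀ - (b - β)) = M + β := by
    have : ((m + n₀ : ℤ) : ℝ) = M := by exact_mod_cast hM
    push_cast at this
    linarith
  obtain ⟨y, r, hy, hr, hys⟩ := exists_hasSum_add_residual (t := fun n => ξ (g (n + n₀)))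
    (fun n => hξ _) hn₀ hβ (u := fun n => u (n + M)) (fun n => hu _)
    (fun v => (hasSum_nat_add_iff' M).2 (hq v)) hC (fun v => by
      have : 0 ≤ ∑ i ∈ Finset.range M, ‖inner ℂ (u i) v‖ ^ 2 :=
        Finset.sum_nonneg fun _ _ => by positivity
      linarith [hqC v])
  obtain ⟨x, hx, hxs⟩ := exists_hasSum_of_hasSum ht hu (r₀ := r) (M := M)
    (by rw [hr]; exact hn₀.le) (by rw [hr, ← hM']; exact htsum)
  have hhinj : Function.Injective fun n => (g (n + n₀) : ι) := fun i j h =>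
    Nat.add_right_cancel (hginj h)
  have hx0 : ∀ n, x (g (n + n₀)) = 0 := fun n => by
    have := hx (g (n + n₀))
    rw [htg] at this
    simpa [tL] using this
  refine ⟨Function.extend (fun n => (g (n + n₀) : ι)) y x, fun i => ?_, fun v => ?_⟩
  · rcases hcases i with h | ⟨n, rfl⟩
    · rw [Function.extend_apply' _ _ _ (by rintro ⟨n, rfl⟩; exact hgS _ h), hx, htS i h]
    · rcases lt_or_ge n n₀ with h | h
      · rw [Function.extend_apply', hx, htg]
        · exact if_pos h
        · rintro ⟨j, hj⟩
          have := hginj hj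
          omega
      · obtain ⟨j, rfl⟩ := Nat.exists_eq_add_of_le' h
        rw [hhinj.extend_apply, hy]
  · have h1 := (hxs v).add ((hasSum_extend_zero hhinj).2 (hys v))
    convert h1 using 1
    · ext i
      by_cases h : ∃ n, (g (n + n₀) : ι) = i
      · obtain ⟨n, rfl⟩ := h
        rw [hhinj.extend_apply, hhinj.extend_apply, hx0]
        simp
      · rw [Function.extend_apply' _ _ _ h, Function.extend_apply' _ _ _ h]
        simp
    · ring

theorem KadisonCondition.exists_hasSum [CompleteSpace H] [Nontrivial H] [Countable ι]
    (hξ : KadisonCondition ξ) {K : Type*} [Countable K] {w : K → H} (hw : ∀ k, ‖w k‖ = 1)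
    {q : H → ℝ} (hq : ∀ v, HasSum (fun k => ‖inner ℂ (w k) v‖ ^ 2) (q v)) {C : ℝ} (hC : 0 ≤ C)
    (hqC : ∀ v, q v ≤ C * ‖v‖ ^ 2)
    (htr : ∑' k, ENNReal.ofReal (‖w k‖ ^ 2) = ∑' i, ENNReal.ofReal (ξ i)) :
    ∃ x : ι → H, (∀ i, ‖x i‖ ^ 2 = ξ i) ∧
      ∀ v, HasSum (fun i => ‖inner ℂ (x i) v‖ ^ 2) (q v) := by
  simp only [hw, one_pow, ENNReal.ofReal_one] at htr
  rcases finite_or_infinite K with hK | hK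
  · obtain ⟨M, ⟨f⟩⟩ := Finite.exists_equiv_fin K
    have hsum : ∑' i, ENNReal.ofReal (ξ i) = M := by
      rw [← htr, ← f.symm.tsum_eq, tsum_fintype]
      simp
    have hsum' : HasSum ξ M := by
      have := hasSum_toReal_tsum_ofReal (fun i => (hξ.1 i).1) (by rw [hsum]; simp)
      rwa [hsum, ENNReal.toReal_natCast] at this
    obtain ⟨u₀, hu₀⟩ := exists_norm_eq H zero_le_one
    obtain ⟨x, hx, hs⟩ := exists_hasSum_of_hasSum (r₀ := (0 : H)) (M := M) hξ.1
      (u := fun n => if h : n < M then w (f.symm ⟨n, h⟩) else u₀)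
      (fun n => by split_ifs <;> simp [hw, hu₀]) (by simp) (by simpa using hsum')
    refine ⟨x, hx, fun v => ?_⟩
    convert hs v using 1
    have h1 := (f.symm.hasSum_iff (f := fun k => ‖inner ℂ (w k) v‖ ^ 2)).2 (hq v)
    rw [h1.unique (hasSum_fintype _), Finset.sum_range]
    simp
  · obtain ⟨g⟩ : Nonempty (ℕ ≃ K) := nonempty_equiv_of_countable
    have hq' : ∀ v, HasSum (fun n => ‖inner ℂ (w (g n)) v‖ ^ 2) (q v) := fun v =>
      (g.hasSum_iff (f := fun k => ‖inner ℂ (w k) v‖ ^ 2)).2 (hq v)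
    have hns : ¬ Summable ξ := fun hs => by
      refine hs.tsum_ofReal_ne_top ?_
      rw [← htr, ENNReal.tsum_const_eq_top_of_ne_zero one_ne_zero]
    rcases hξ.2 with h | ⟨ha, hb, m, hm⟩
    · exact exists_hasSum_of_not_summable_min_of_countable hξ.1 (not_summable_min_of_add_eq_top h)
        (fun n => hw (g n)) hq'
    · exact exists_hasSum_of_tsum_ne_top hξ.1 hns ha hb hm (fun n => hw (g n)) hq' hC hqC

end Kadison

theorem mainTheorem1 {H : Type*} [NormedAddCommGroup H] [InnerProductSpace ℂ H]
    [CompleteSpace H] [TopologicalSpace.SeparableSpace H] [Nontrivial H]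
    {κ : Type*} (e : HilbertBasis κ ℂ H)
    {ι : Type*} [Countable ι] (ξ : ι → ℝ) (hξ : KadisonCondition ξ)
    (A : H →L[ℂ] H) (hA : IsSumOfProjections A)
    (htr : positiveTrace e A = ∑' j, ENNReal.ofReal (ξ j)) :
    IsAdmissible ξ A := by
  obtain ⟨s, hs, hw, hq⟩ := hA.exists_unit_family
  rw [positiveTrace_eq_tsum_norm_sq e hA.isPositive hq] at htr
  obtain ⟨x, hx, hxs⟩ := hξ.exists_hasSum hw hq (norm_nonneg A) A.re_inner_apply_le htr
  exact isAdmissible_of_hasSum hA.isPositive hx hxs
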